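/- All spaces are $T_1$. A space $X$ satisfies well-ordered $(F)$ if there is a family $\mathcal W=\{\mathcal W(x):x\in X\}$ such that each $\mathcal W(x)$ is a collection of subsets of $X$ containing $x$ which is well-ordered under reverse inclusion, and such that whenever $x$ belongs to an open set $U$, there is an open set $V=V(x,U)$ containing $x$ such that for every $y\in V$ there is $W\in\mathcal W(y)$ with $x\in W\subseteq U$. A space locally satisfies well-ordered $(F)$ if every point has a neighborhood that satisfies well-ordered $(F)$ as a subspace. A space is paracompact if it is Hausdorff and every open cover has a locally finite open refinement that covers the space. **Theorem.** A ($T_1$) space satisfies well-ordered $(F)$ if and only if it is paracompact and locally satisfies well-ordered $(F)$. -/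

import Mathlib

open Topology

/-- `W = {W x : x ∈ X}` satisfies condition (F): each `W x` consists of subsets of `X` containing
`x`, and whenever `x` belongs to an open set `U` there is an open `V ∋ x` such that for every
`y ∈ V` some `A ∈ W y` satisfies `x ∈ A ⊆ U`. -/
def ConditionF {X : Type*} [TopologicalSpace X] (W : X → Set (Set X)) : Prop :=
  (∀ x, ∀ A ∈ W x, x ∈ A) ∧
    ∀ x, ∀ U : Set X, IsOpen U → x ∈ U →
      ∃ V : Set X, IsOpen V ∧ x ∈ V ∧ ∀ y ∈ V, ∃ A ∈ W y, x ∈ A ∧ A ⊆ U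

/-- The space `X` satisfies well-ordered (F): it has a family `W` satisfying condition (F) such that
each `W x` is well-ordered by reverse inclusion (`A` strictly precedes `B` iff `B ⊂ A`). -/
def WellOrderedF (X : Type*) [TopologicalSpace X] : Prop :=
  ∃ W : X → Set (Set X), ConditionF W ∧
    ∀ x, IsWellOrder (W x) (fun A B => (B : Set X) ⊂ (A : Set X))

/-- The space `X` locally satisfies well-ordered (F): every point has a neighborhood which, with
the subspace topology, satisfies well-ordered (F). -/
def LocallyWellOrderedF (X : Type*) [TopologicalSpace X] : Prop :=
  ∀ x : X, ∃ N ∈ 𝓝 x, WellOrderedF N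

/-!
If `X` satisfies well-ordered (F) and `U` is an open cover, send each point `y` to an index `i y`
such that `U (i y)` contains the largest member of `W y` lying inside a member of the cover.
Condition (F) makes the fibres of `i` cushioned in `U`: when `y` is close to `x`, that largest
member contains `x`. By Michael's theorem a space all of whose open covers have cushioned
refinements is normal and paracompact: well-order the indices and, at each of countably many stages,
refine what the closures of earlier members of the previous refinement leave of `U`. The open sets
that only one member of a stage meets then form a σ-disjoint refinement of `U`.

Conversely, normality and paracompactness turn a cover by neighbourhoods satisfying well-ordered (F)
into a locally finite closed cover by such subspaces. Each point then takes its family from one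
member containing it; a point near `x` only ever chooses among the finitely many members
containing `x`.
-/

open Function Set Filter

section ReverseWellOrder

variable {α β : Type*} [PartialOrder α] [PartialOrder β]

theorem isWellOrder_gt_iff_exists_isGreatest {s : Set α} :
    IsWellOrder s (fun a b => (b : α) < a) ↔ ∀ t ⊆ s, t.Nonempty → ∃ a, IsGreatest t a := by
  constructor
  · rintro h t hts ⟨b, hb⟩
    obtain ⟨a, ha, hmin⟩ := h.wf.has_min {a : s | (a : α) ∈ t} ⟨⟨b, hts hb⟩, hb⟩
    refine ⟨a, ha, fun c hc => ?_⟩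
    rcases trichotomous_of (fun a b : s => (b : α) < a) a ⟨c, hts hc⟩ with hca | rfl | hac
    · exact hca.le
    · exact le_rfl
    · exact absurd hac (hmin _ hc)
  · intro h
    have hwf : WellFounded fun a b : s => (b : α) < a := by
      refine WellFounded.wellFounded_iff_has_min.2 fun t ht => ?_
      obtain ⟨_, ⟨a, ha, rfl⟩, hmax⟩ := h _ (Subtype.coe_image_subset s t) (ht.image _)
      exact ⟨a, ha, fun b hb => (hmax (mem_image_of_mem _ hb)).not_gt⟩
    refine { wf := hwf, trichotomous := fun a b hab hba => Subtype.ext ?_ }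
    obtain ⟨c, rfl | rfl, hmax⟩ := h {(a : α), (b : α)} (pair_subset a.2 b.2) (insert_nonempty _ _)
    · exact ((hmax (Or.inr rfl)).eq_of_not_lt hab).symm
    · exact (hmax (Or.inl rfl)).eq_of_not_lt hba

theorem isWellOrder_gt_image {s : Set α} {g : α → β} (hg : MonotoneOn g s)
    (h : IsWellOrder s (fun a b => (b : α) < a)) :
    IsWellOrder (g '' s) (fun a b => (b : β) < a) := by
  rw [isWellOrder_gt_iff_exists_isGreatest] at h ⊢
  intro t hts ht
  obtain ⟨u, hus, rfl⟩ := subset_image_iff.1 hts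
  obtain ⟨a, ha⟩ := h u hus ht.of_image
  exact ⟨g a, (hg.mono hus).map_isGreatest ha⟩

end ReverseWellOrder

section ConditionF

variable {X Y ι : Type*} [TopologicalSpace X] [TopologicalSpace Y]

theorem conditionF_iff_eventually {W : X → Set (Set X)} :
    ConditionF W ↔ (∀ x, ∀ A ∈ W x, x ∈ A) ∧
      ∀ x, ∀ U ∈ 𝓝 x, ∀ᶠ y in 𝓝 x, ∃ A ∈ W y, x ∈ A ∧ A ⊆ U := by
  refine and_congr_right fun _ => forall_congr' fun x => ⟨fun h U hU => ?_, fun h U hU hx => ?_⟩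
  · obtain ⟨U', hU'U, hU', hxU'⟩ := mem_nhds_iff.1 hU
    obtain ⟨V, hV, hxV, hVW⟩ := h U' hU' hxU'
    filter_upwards [hV.mem_nhds hxV] with y hy
    obtain ⟨A, hA, hxA, hAU'⟩ := hVW y hy
    exact ⟨A, hA, hxA, hAU'.trans hU'U⟩
  · obtain ⟨V, hVW, hV, hxV⟩ := eventually_nhds_iff.1 (h U (hU.mem_nhds hx))
    exact ⟨V, hV, hxV, hVW⟩

theorem WellOrderedF.of_isInducing {f : Y → X} (hf : IsInducing f) (h : WellOrderedF X) :
    WellOrderedF Y := by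
  obtain ⟨W, hW, hwo⟩ := h
  rw [conditionF_iff_eventually] at hW
  refine ⟨fun y => preimage f '' W (f y), conditionF_iff_eventually.2 ⟨?_, fun y U hU => ?_⟩,
    fun y => isWellOrder_gt_image (monotone_preimage.monotoneOn _) (hwo (f y))⟩
  · rintro y _ ⟨A, hA, rfl⟩
    exact hW.1 _ A hA
  · obtain ⟨U', hU', hU'U⟩ := (hf.nhds_eq_comap y ▸ hU : U ∈ comap f (𝓝 (f y)))
    filter_upwards [hf.continuous.continuousAt.eventually (hW.2 (f y) U' hU')]
      with z ⟨A, hA, hyA, hAU'⟩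
    exact ⟨f ⁻¹' A, mem_image_of_mem _ hA, hyA, (preimage_mono hAU').trans hU'U⟩

theorem ConditionF.eventually_of_subtype {S : Set X} {W : S → Set (Set S)} (hW : ConditionF W)
    {x : X} (hx : x ∈ S) {U : Set X} (hU : U ∈ 𝓝 x) :
    ∀ᶠ y in 𝓝 x, ∀ hy : y ∈ S,
      ∃ A ∈ W ⟨y, hy⟩, x ∈ Subtype.val '' A ∧ Subtype.val '' A ⊆ U := by
  have hnear := (conditionF_iff_eventually.1 hW).2 ⟨x, hx⟩ (Subtype.val ⁻¹' U)
    (continuous_subtype_val.continuousAt.preimage_mem_nhds hU)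
  rw [nhds_subtype_eq_comap, eventually_comap] at hnear
  filter_upwards [hnear] with y hyW hy
  obtain ⟨A, hA, hxA, hAU⟩ := hyW ⟨y, hy⟩ rfl
  exact ⟨A, hA, mem_image_of_mem _ hxA, image_subset_iff.2 hAU⟩

theorem WellOrderedF.of_locallyFinite_isClosed {F : ι → Set X} (hlf : LocallyFinite F)
    (hF : ∀ i, IsClosed (F i)) (hcov : ⋃ i, F i = univ) (h : ∀ i, WellOrderedF (F i)) :
    WellOrderedF X := by
  choose W hW hwo using h
  choose i hi using iUnion_eq_univ_iff.1 hcov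
  refine ⟨fun y => image Subtype.val '' W (i y) ⟨y, hi y⟩,
    conditionF_iff_eventually.2 ⟨?_, fun x U hU => ?_⟩,
    fun y => isWellOrder_gt_image (monotone_image.monotoneOn _) (hwo _ _)⟩
  · rintro y _ ⟨A, hA, rfl⟩
    exact mem_image_of_mem _ ((hW _).1 _ A hA)
  · have hnear := (eventually_all_finite (hlf.point_finite x)).2 fun k hk =>
      (hW k).eventually_of_subtype hk hU
    filter_upwards [hnear, hlf.iInter_compl_mem_nhds hF x] with y hyW hyF
    have hx : x ∈ F (i y) := by
      by_contra hx
      exact mem_iInter₂.1 hyF (i y) hx (hi y)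
    obtain ⟨A, hA, hxA, hAU⟩ := hyW (i y) hx (hi y)
    exact ⟨_, mem_image_of_mem _ hA, hxA, hAU⟩

theorem LocallyWellOrderedF.wellOrderedF [NormalSpace X] [ParacompactSpace X]
    (h : LocallyWellOrderedF X) : WellOrderedF X := by
  choose N hN hwo using h
  obtain ⟨O, hO, hOcov, hlf, hON⟩ := precise_refinement (fun x => interior (N x))
    (fun _ => isOpen_interior)
    (iUnion_eq_univ_iff.2 fun x => ⟨x, mem_interior_iff_mem_nhds.2 (hN x)⟩)
  obtain ⟨F, hFcov, hF, hFO⟩ := exists_iUnion_eq_closed_subset hO hlf.point_finite hOcov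
  have hFN : ∀ x, F x ⊆ N x := fun x => (hFO x).trans ((hON x).trans interior_subset)
  exact .of_locallyFinite_isClosed (hlf.subset hFO) hF hFcov fun x =>
    (hwo x).of_isInducing (IsEmbedding.inclusion (hFN x)).isInducing

end ConditionF

section Cushioned

universe u

variable {X : Type u} [TopologicalSpace X] {ι κ : Type*}

/-- `C` is a cushioned refinement of `U` in the sense of Michael: `C` is a cover, indexed like `U`,
such that the closure of every subunion of `C` lies in the corresponding subunion of `U`. -/
structure IsCushionedRefinement (C U : ι → Set X) : Prop where
  iUnion_eq_univ : ⋃ i, C i = univ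
  closure_biUnion_subset : ∀ J : Set ι, closure (⋃ j ∈ J, C j) ⊆ ⋃ j ∈ J, U j

namespace IsCushionedRefinement

variable {C U U' : ι → Set X}

theorem exists_mem (h : IsCushionedRefinement C U) (x : X) : ∃ i, x ∈ C i :=
  iUnion_eq_univ_iff.1 h.iUnion_eq_univ x

theorem mono (h : IsCushionedRefinement C U) (hU : ∀ i, U i ⊆ U' i) :
    IsCushionedRefinement C U' :=
  ⟨h.iUnion_eq_univ, fun J => (h.closure_biUnion_subset J).trans (iUnion₂_mono fun i _ => hU i)⟩

theorem closure_subset (h : IsCushionedRefinement C U) (i : ι) : closure (C i) ⊆ U i := by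
  simpa only [biUnion_singleton] using h.closure_biUnion_subset {i}

theorem subset (h : IsCushionedRefinement C U) (i : ι) : C i ⊆ U i :=
  subset_closure.trans (h.closure_subset i)

theorem reindex {D V : κ → Set X} (h : IsCushionedRefinement D V) {σ : κ → ι}
    (hσ : ∀ k, V k ⊆ U (σ k)) :
    IsCushionedRefinement (fun i => ⋃ k ∈ σ ⁻¹' {i}, D k) U where
  iUnion_eq_univ := by
    refine iUnion_eq_univ_iff.2 fun x => ?_
    obtain ⟨k, hk⟩ := h.exists_mem x
    exact ⟨σ k, mem_biUnion (mem_singleton (σ k)) hk⟩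
  closure_biUnion_subset J := by
    have hD : ⋃ i ∈ J, ⋃ k ∈ σ ⁻¹' {i}, D k ⊆ ⋃ k ∈ σ ⁻¹' J, D k :=
      iUnion₂_subset fun i hi => biUnion_subset_biUnion_left fun k (hk : σ k = i) =>
        mem_preimage.2 (hk ▸ hi)
    refine (closure_mono hD).trans ((h.closure_biUnion_subset _).trans ?_)
    exact iUnion₂_subset fun k hk => (hσ k).trans (subset_biUnion_of_mem (u := U) hk)

end IsCushionedRefinement

/-- Every open cover of `X` has a cushioned refinement. As for `ParacompactSpace`, index types are
restricted to the universe of `X`; `HasCushionedRefinements.exists_isCushionedRefinement` lifts the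
restriction. -/
def HasCushionedRefinements (X : Type u) [TopologicalSpace X] : Prop :=
  ∀ (ι : Type u) (U : ι → Set X), (∀ i, IsOpen (U i)) → ⋃ i, U i = univ →
    ∃ C : ι → Set X, IsCushionedRefinement C U

theorem WellOrderedF.hasCushionedRefinements (h : WellOrderedF X) :
    HasCushionedRefinements X := by
  intro ι U hU hcov
  obtain ⟨W, hW, hwo⟩ := h
  rw [conditionF_iff_eventually] at hW
  choose i hi using iUnion_eq_univ_iff.1 hcov
  have hnear : ∀ x, ∀ᶠ y in 𝓝 x, ∃ A ∈ W y, x ∈ A ∧ A ⊆ U (i x) := fun x =>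
    hW.2 x _ ((hU _).mem_nhds (hi x))
  have hgreatest : ∀ y, ∃ A, IsGreatest {A ∈ W y | ∃ j, A ⊆ U j} A := fun y => by
    obtain ⟨A, hA, -, hAU⟩ := (hnear y).self_of_nhds
    exact isWellOrder_gt_iff_exists_isGreatest.1 (hwo y) _ (sep_subset _ _) ⟨A, hA, _, hAU⟩
  choose A hA hAmax using hgreatest
  choose j hj using fun y => (hA y).2
  refine ⟨fun k => j ⁻¹' {k}, iUnion_eq_univ_iff.2 fun x => ⟨j x, rfl⟩, fun J x hx => ?_⟩
  rw [biUnion_preimage_singleton] at hx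
  obtain ⟨y, hyJ, B, hB, hxB, hBU⟩ := ((mem_closure_iff_frequently.1 hx).and_eventually
    (hnear x)).exists
  exact mem_biUnion hyJ (hj y (hAmax y ⟨hB, _, hBU⟩ hxB))

namespace HasCushionedRefinements

theorem exists_isCushionedRefinement (h : HasCushionedRefinements X) {U : ι → Set X}
    (hU : ∀ i, IsOpen (U i)) (hcov : ⋃ i, U i = univ) :
    ∃ C : ι → Set X, IsCushionedRefinement C U := by
  obtain ⟨C, hC⟩ := h (range U) Subtype.val (forall_subtype_range_iff.2 hU)
    (by rwa [← sUnion_eq_iUnion, sUnion_range])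
  exact ⟨_, hC.reindex (σ := rangeSplitting U) fun A => (apply_rangeSplitting U A).ge⟩

theorem exists_isClosed_subset (h : HasCushionedRefinements X) {U : ι → Set X}
    (hU : ∀ i, IsOpen (U i)) (hcov : ⋃ i, U i = univ) :
    ∃ K : ι → Set X, (∀ i, IsClosed (K i)) ∧ (∀ i, K i ⊆ U i) ∧ ⋃ i, K i = univ := by
  obtain ⟨C, hC⟩ := h.exists_isCushionedRefinement hU hcov
  exact ⟨fun i => closure (C i), fun _ => isClosed_closure, hC.closure_subset,
    univ_subset_iff.1 (hC.iUnion_eq_univ ▸ iUnion_mono fun _ => subset_closure)⟩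

theorem normalSpace (h : HasCushionedRefinements X) : NormalSpace X := by
  refine ⟨fun A B hA hB hAB => ?_⟩
  obtain ⟨K, hK, hKU, hcov⟩ := h.exists_isClosed_subset (U := fun b : Bool => cond b Aᶜ Bᶜ)
    (Bool.forall_bool.2 ⟨hB.isOpen_compl, hA.isOpen_compl⟩)
    (by rw [← union_eq_iUnion, ← compl_inter, hAB.inter_eq, compl_empty])
  refine ⟨(K true)ᶜ, (K false)ᶜ, (hK _).isOpen_compl, (hK _).isOpen_compl,
    subset_compl_comm.1 (hKU true), subset_compl_comm.1 (hKU false), ?_⟩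
  have hKcov : K true ∪ K false = univ := iSup_bool_eq.symm.trans hcov
  rw [disjoint_iff_inter_eq_empty, ← compl_union, hKcov, compl_univ]

end HasCushionedRefinements

/-- The points having a neighbourhood disjoint from every `C j` with `j ≠ i`. This is how pairwise
disjoint open sets are extracted from a cover by arbitrary sets. -/
def exclusivePart (C : ι → Set X) (i : ι) : Set X :=
  (closure (⋃ j ∈ ({i}ᶜ : Set ι), C j))ᶜ

theorem isOpen_exclusivePart (C : ι → Set X) (i : ι) : IsOpen (exclusivePart C i) :=
  isClosed_closure.isOpen_compl

theorem notMem_of_mem_exclusivePart {C : ι → Set X} {i j : ι} (hij : j ≠ i) {x : X}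
    (hx : x ∈ exclusivePart C i) : x ∉ C j := fun hxj =>
  hx (subset_closure (mem_biUnion (mem_compl_singleton_iff.2 hij) hxj))

theorem exclusivePart_subset {C : ι → Set X} (hC : ⋃ i, C i = univ) (i : ι) :
    exclusivePart C i ⊆ C i := by
  intro x hx
  obtain ⟨j, hj⟩ := iUnion_eq_univ_iff.1 hC x
  obtain rfl : j = i := by
    by_contra hij
    exact notMem_of_mem_exclusivePart hij hx hj
  exact hj

theorem pairwise_disjoint_exclusivePart {C : ι → Set X} (hC : ⋃ i, C i = univ) :
    Pairwise (Disjoint on exclusivePart C) := fun i _ hij =>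
  disjoint_left.2 fun _ hxi hxj =>
    notMem_of_mem_exclusivePart hij hxj (exclusivePart_subset hC i hxi)

section LinearOrder

variable [LinearOrder ι]

theorem mem_exclusivePart_iff {C : ι → Set X} {i : ι} {x : X} :
    x ∈ exclusivePart C i ↔
      x ∉ closure (⋃ j ∈ Iio i, C j) ∧ x ∉ closure (⋃ j ∈ Ioi i, C j) := by
  rw [exclusivePart, ← Iio_union_Ioi, biUnion_union, closure_union, compl_union]
  rfl

/-- What remains of each `U i` after deleting the closure of the union of the earlier members of
`C`: the open cover to which the next cushioned refinement in Michael's argument is applied. -/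
def sdiffClosureIio (U C : ι → Set X) (i : ι) : Set X :=
  U i \ closure (⋃ j ∈ Iio i, C j)

variable [WellFoundedLT ι] {U : ι → Set X}

theorem IsCushionedRefinement.iUnion_sdiffClosureIio {C : ι → Set X} (h : IsCushionedRefinement C U)
    (hcov : ⋃ i, U i = univ) : ⋃ i, sdiffClosureIio U C i = univ := by
  refine iUnion_eq_univ_iff.2 fun x => ?_
  obtain ⟨i, hi, hmin⟩ := wellFounded_lt.has_min {i | x ∈ U i} (iUnion_eq_univ_iff.1 hcov x)
  refine ⟨i, hi, fun hx => ?_⟩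
  obtain ⟨j, hji, hj⟩ := mem_iUnion₂.1 (h.closure_biUnion_subset _ hx)
  exact hmin j hj hji

theorem HasCushionedRefinements.exists_seq_sdiffClosureIio (h : HasCushionedRefinements X)
    (hU : ∀ i, IsOpen (U i)) (hcov : ⋃ i, U i = univ) :
    ∃ C : ℕ → ι → Set X, (∀ n, IsCushionedRefinement (C n) U) ∧
      ∀ n, IsCushionedRefinement (C (n + 1)) (sdiffClosureIio U (C n)) := by
  have hstep : ∀ C : {C : ι → Set X // IsCushionedRefinement C U},
      ∃ D : {D : ι → Set X // IsCushionedRefinement D U},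
        IsCushionedRefinement D.1 (sdiffClosureIio U C.1) := fun ⟨C, hC⟩ => by
    obtain ⟨D, hD⟩ := h.exists_isCushionedRefinement
      (fun i => (hU i).sdiff isClosed_closure) (hC.iUnion_sdiffClosureIio hcov)
    exact ⟨⟨D, hD.mono fun _ => sdiff_subset⟩, hD⟩
  choose next hnext using hstep
  obtain ⟨C₀, hC₀⟩ := h.exists_isCushionedRefinement hU hcov
  let C (n : ℕ) : {C : ι → Set X // IsCushionedRefinement C U} :=
    n.rec ⟨C₀, hC₀⟩ fun _ => next
  exact ⟨fun n => (C n).1, fun n => (C n).2, fun n => hnext (C n)⟩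

theorem iUnion_exclusivePart_of_sdiffClosureIio {C : ℕ → ι → Set X}
    (hC : ∀ n, IsCushionedRefinement (C (n + 1)) (sdiffClosureIio U (C n))) :
    ⋃ n, ⋃ i, exclusivePart (C n) i = univ := by
  refine iUnion_eq_univ_iff.2 fun x => ?_
  obtain ⟨i, ⟨n, hn⟩, hmin⟩ := wellFounded_lt.has_min {i | ∃ n, x ∈ C n i}
    (((hC 0).exists_mem x).imp fun _ hi => ⟨1, hi⟩)
  refine ⟨n + 1, mem_iUnion.2 ⟨i, mem_exclusivePart_iff.2 ⟨fun hlt => ?_, fun hgt => ?_⟩⟩⟩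
  -- Stage `n + 2` covers `x`, which keeps `x` off the members of stage `n + 1` before `i`;
  -- stage `n` has `x ∈ C n i`, which keeps `x` off the members of stage `n + 1` after `i`.
  · obtain ⟨k, hk⟩ := (hC (n + 1)).exists_mem x
    have hik : i ≤ k := not_lt.1 (hmin k ⟨_, hk⟩)
    exact ((hC (n + 1)).subset k hk).2
      (closure_mono (biUnion_subset_biUnion_left (Iio_subset_Iio hik)) hlt)
  · obtain ⟨k, hik, -, hk⟩ := mem_iUnion₂.1 ((hC n).closure_biUnion_subset _ hgt)
    exact hk (subset_closure (mem_biUnion (mem_Iio.2 hik) hn))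

theorem HasCushionedRefinements.exists_sigma_disjoint (h : HasCushionedRefinements X)
    (hU : ∀ i, IsOpen (U i)) (hcov : ⋃ i, U i = univ) :
    ∃ V : ℕ → ι → Set X, (∀ n i, IsOpen (V n i)) ∧ (∀ n i, V n i ⊆ U i) ∧
      (∀ n, Pairwise (Disjoint on V n)) ∧ ⋃ n, ⋃ i, V n i = univ := by
  obtain ⟨C, hC, hres⟩ := h.exists_seq_sdiffClosureIio hU hcov
  have hCcov n := (hC n).iUnion_eq_univ
  exact ⟨fun n => exclusivePart (C n), fun n => isOpen_exclusivePart (C n),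
    fun n i => (exclusivePart_subset (hCcov n) i).trans ((hC n).subset i),
    fun n => pairwise_disjoint_exclusivePart (hCcov n),
    iUnion_exclusivePart_of_sdiffClosureIio hres⟩

end LinearOrder

theorem exists_locallyFinite_closure_subset [NormalSpace X] {K O : ℕ → Set X}
    (hK : ∀ n, IsClosed (K n)) (hO : ∀ n, IsOpen (O n)) (hKO : ∀ n, K n ⊆ O n)
    (hcov : ⋃ n, K n = univ) :
    ∃ H : ℕ → Set X, (∀ n, IsOpen (H n)) ∧ (∀ n, closure (H n) ⊆ O n) ∧ LocallyFinite H ∧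
      ⋃ n, H n = univ := by
  choose G hG hKG hGO using fun n => normal_exists_closure_subset (hK n) (hO n) (hKO n)
  choose G' hG' hKG' hG'G using fun n => normal_exists_closure_subset (hK n) (hG n) (hKG n)
  refine ⟨fun n => G n \ ⋃ m ∈ Iio n, closure (G' m), fun n => ?_, fun n => ?_, fun x => ?_, ?_⟩
  · exact (hG n).sdiff ((finite_Iio n).isClosed_biUnion fun _ _ => isClosed_closure)
  · exact (closure_mono sdiff_subset).trans (hGO n)
  · obtain ⟨k, hk⟩ := iUnion_eq_univ_iff.1 hcov x
    refine ⟨G' k, (hG' k).mem_nhds (hKG' k hk), (finite_Iic k).subset ?_⟩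
    rintro n ⟨y, ⟨-, hyn⟩, hyk⟩
    exact not_lt.1 fun hkn => hyn (mem_biUnion (mem_Iio.2 hkn) (subset_closure hyk))
  · rw [← univ_subset_iff, ← hcov]
    refine (iUnion_mono hKG).trans (iUnion_disjointed.ge.trans (iUnion_mono fun n => ?_))
    rw [disjointed_apply, Finset.sup_set_eq_biUnion]
    exact sdiff_subset_sdiff_right (iUnion₂_mono' fun m hm => ⟨m, Finset.mem_Iio.2 hm, hG'G m⟩)

theorem locallyFinite_inter_of_pairwise_disjoint {H : κ → Set X} {V : κ → ι → Set X}
    (hH : LocallyFinite H) (hV : ∀ k i, IsOpen (V k i)) (hdisj : ∀ k, Pairwise (Disjoint on V k))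
    (hHV : ∀ k, closure (H k) ⊆ ⋃ i, V k i) :
    LocallyFinite fun p : κ × ι => V p.1 p.2 ∩ H p.1 := by
  intro x
  have hrow : ∀ k, ∃ T ∈ 𝓝 x, {i | (V k i ∩ H k ∩ T).Nonempty}.Finite := fun k => by
    by_cases hx : x ∈ closure (H k)
    · obtain ⟨i, hi⟩ := mem_iUnion.1 (hHV k hx)
      refine ⟨V k i, (hV k i).mem_nhds hi, (finite_singleton i).subset ?_⟩
      rintro j ⟨y, ⟨hyj, -⟩, hyi⟩
      exact (hdisj k).eq (not_disjoint_iff.2 ⟨y, hyj, hyi⟩)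
    · refine ⟨(closure (H k))ᶜ, isClosed_closure.isOpen_compl.mem_nhds hx,
        finite_empty.subset ?_⟩
      rintro j ⟨y, ⟨-, hyH⟩, hy⟩
      exact hy (subset_closure hyH)
  choose T hT hTfin using hrow
  obtain ⟨S, hS, hSfin⟩ := hH x
  refine ⟨S ∩ ⋂ k ∈ {k | (H k ∩ S).Nonempty}, T k,
    inter_mem hS ((biInter_mem hSfin).2 fun k _ => hT k),
    (hSfin.biUnion fun k _ => (hTfin k).image (Prod.mk k)).subset ?_⟩
  rintro ⟨k, i⟩ ⟨y, ⟨hyV, hyH⟩, hyS, hyT⟩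
  have hk : k ∈ {k | (H k ∩ S).Nonempty} := ⟨y, hyH, hyS⟩
  exact mem_biUnion hk ⟨i, ⟨y, ⟨hyV, hyH⟩, mem_iInter₂.1 hyT k hk⟩, rfl⟩

theorem HasCushionedRefinements.paracompactSpace (h : HasCushionedRefinements X) :
    ParacompactSpace X := by
  have := h.normalSpace
  refine ⟨fun ι U hU hcov => ?_⟩
  obtain ⟨_, _⟩ := exists_wellFoundedLT ι
  obtain ⟨V, hV, hVU, hdisj, hVcov⟩ := h.exists_sigma_disjoint hU hcov
  have hO : ∀ n, IsOpen (⋃ i, V n i) := fun n => isOpen_iUnion (hV n)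
  obtain ⟨K, hK, hKO, hKcov⟩ := h.exists_isClosed_subset hO hVcov
  obtain ⟨H, hH, hHO, hlf, hHcov⟩ := exists_locallyFinite_closure_subset hK hO hKO hKcov
  refine ⟨ℕ × ι, fun p => V p.1 p.2 ∩ H p.1, fun p => (hV _ _).inter (hH _),
    iUnion_eq_univ_iff.2 fun x => ?_, locallyFinite_inter_of_pairwise_disjoint hlf hV hdisj hHO,
    fun p => ⟨p.2, inter_subset_left.trans (hVU _ _)⟩⟩
  obtain ⟨n, hn⟩ := iUnion_eq_univ_iff.1 hHcov x
  obtain ⟨i, hi⟩ := mem_iUnion.1 (hHO n (subset_closure hn))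
  exact ⟨(n, i), hi, hn⟩

end Cushioned

theorem theorem3p2_general (X : Type*) [TopologicalSpace X] :
    WellOrderedF X ↔ (NormalSpace X ∧ ParacompactSpace X) ∧ LocallyWellOrderedF X := by
  constructor
  · intro h
    have hc := h.hasCushionedRefinements
    exact ⟨⟨hc.normalSpace, hc.paracompactSpace⟩,
      fun _ => ⟨univ, univ_mem, h.of_isInducing IsInducing.subtypeVal⟩⟩
  · rintro ⟨⟨_, _⟩, h⟩
    exact h.wellOrderedF

theorem theorem3p2 (X : Type*) [TopologicalSpace X] [T1Space X] :
    WellOrderedF X ↔ (T2Space X ∧ ParacompactSpace X) ∧ LocallyWellOrderedF X := by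
  rw [theorem3p2_general]
  exact and_congr_left' (and_congr_left fun _ =>
    ⟨fun _ => have : T4Space X := {}; inferInstance, fun _ => inferInstance⟩)
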